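/- **Lemma (An over-parameterized projection error bound).** *Notation.* For a real tensor $\mathcal A\in\mathbb R^{p_1\times\cdots\times p_N}$ let $\|\mathcal A\|_F$ be its Frobenius norm, $\mathcal M_k(\mathcal A)\in\mathbb R^{p_k\times\prod_{l\ne k}p_l}$ its mode-$k$ matricization, $\mathcal T_k$ the inverse of $\mathcal M_k$, $\times_k$ the mode-$k$ tensor-matrix product, and $\mathrm{Tucrank}(\mathcal A)=(\operatorname{rank}\mathcal M_1(\mathcal A),\dots,\operatorname{rank}\mathcal M_N(\mathcal A))$ its Tucker rank. Let $\sigma_j(M)$ be the $j$-th largest singular value of a matrix $M$, and $P_U=UU^\top$ for a matrix $U$ with orthonormal columns. Let $\mathcal X$ have Tucker rank $\mathbf r=(r_1,\dots,r_N)$. Then $\mathcal X$ has a Tucker decomposition $\mathcal X=\mathcal S\times_1U_1\cdots\times_NU_N$ with core $\mathcal S\in\mathbb R^{r_1\times\cdots\times r_N}$ and $U_k\in\mathbb R^{p_k\times r_k}$, $U_k^\top U_k=I_{r_k}$. For any such decomposition, let $V_k$ have $r_k$ orthonormal columns spanning the row space of $\mathcal M_k(\mathcal S)$, and put $W_k=(U_N\otimes\cdots\otimes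 U_{k+1}\otimes U_{k-1}\otimes\cdots\otimes U_1)V_k$. The projector onto the tangent space at $\mathcal X$ of the manifold of tensors of Tucker rank $\mathbf r$ is $$P_{T_{\mathcal X}}(\mathcal Z)=\mathcal Z\times_1P_{U_1}\cdots\times_NP_{U_N}+\sum_{k=1}^{N}\mathcal T_k\big((I_{p_k}-P_{U_k})\,\mathcal M_k(\mathcal Z)\,P_{W_k}\big),$$ and $P_{(T_{\mathcal X})_\perp}=I-P_{T_{\mathcal X}}$. *Statement.* Let $d+m\ge1$, let $\mathcal X^t\in\mathbb R^{p_1\times\cdots\times p_{d+m}}$ have Tucker rank $\mathbf r=(r_1,\dots,r_{d+m})$, and let $\mathcal X^*\in\mathbb R^{p_1\times\cdots\times p_{d+m}}$ have Tucker rank $\mathbf r^*=(r_1^*,\dots,r_{d+m}^*)$ with $1\le r_k^*\le r_k$ for all $k$. Put $\underline\lambda=\min_{1\le k\le d+m}\sigma_{r_k^*}(\mathcal M_k(\mathcal X^*))$. Then, whichever Tucker decomposition of $\mathcal X^t$ and whichever $V_k$ are used to form $P_{T_{\mathcal X^t}}$, $$\|P_{(T_{\mathcal X^t})_\perp}\mathcal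 X^*\|_F\le\frac{2(d+m)\,\|\mathcal X^t-\mathcal X^*\|_F^2}{\underline\lambda}.$$ In the matrix case $d+m=2$, a sharper bound holds: if $X^t,X^*\in\mathbb R^{p_1\times p_2}$ have ranks $r$ and $r^*$ with $1\le r^*\le r$, then $$\|P_{(T_{X^t})_\perp}X^*\|_F\le\frac{2\,\|X^t-X^*\|_F^2}{\sigma_{r^*}(X^*)}.$$ -/

import Mathlib

open scoped BigOperators Matrix

namespace TuckerProj

noncomputable section

/-- Real tensors of order `N` with mode sizes `p 0, …, p (N - 1)`. -/
abbrev Tensor {N : ℕ} (p : Fin N → ℕ) : Type := (∀ k, Fin (p k)) → ℝ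

/-- Frobenius norm of a tensor. -/
def frobNorm {N : ℕ} {p : Fin N → ℕ} (A : Tensor p) : ℝ := √(∑ i, A i ^ 2)

/-- Multi-indices of all modes other than `k`. These index the columns of the mode-`k`
matricization; the number of them is the product of the `p l` over `l ≠ k`. -/
abbrev OtherIdx {N : ℕ} (p : Fin N → ℕ) (k : Fin N) : Type := ∀ l : {l : Fin N // l ≠ k}, Fin (p l)

/-- Mode-`k` matricization: row index `i k`, column index `(i l)` for `l ≠ k`. -/
def matricize {N : ℕ} {p : Fin N → ℕ} (k : Fin N) (A : Tensor p) :
    Matrix (Fin (p k)) (OtherIdx p k) ℝ :=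
  Matrix.of fun a b => A ((Equiv.piSplitAt k fun l => Fin (p l)).symm (a, b))

/-- Mode-`k` tensorization, the inverse of the mode-`k` matricization. -/
def tensorize {N : ℕ} {p : Fin N → ℕ} (k : Fin N) (M : Matrix (Fin (p k)) (OtherIdx p k) ℝ) :
    Tensor p :=
  fun i => M (i k) fun l => i l

theorem tensorize_matricize {N : ℕ} {p : Fin N → ℕ} (k : Fin N) (A : Tensor p) :
    tensorize k (matricize k A) = A := by
  funext i
  exact congrArg A ((Equiv.piSplitAt k fun l => Fin (p l)).symm_apply_apply i)

theorem matricize_tensorize {N : ℕ} {p : Fin N → ℕ} (k : Fin N)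
    (M : Matrix (Fin (p k)) (OtherIdx p k) ℝ) : matricize k (tensorize k M) = M := by
  ext a b
  have h := (Equiv.piSplitAt k fun l => Fin (p l)).apply_symm_apply (a, b)
  have h1 : ((Equiv.piSplitAt k fun l => Fin (p l)).symm (a, b)) k = a := congrArg Prod.fst h
  have h2 : (fun l : {l : Fin N // l ≠ k} =>
      ((Equiv.piSplitAt k fun l => Fin (p l)).symm (a, b)) l) = b := congrArg Prod.snd h
  show M (((Equiv.piSplitAt k fun l => Fin (p l)).symm (a, b)) k)
    (fun l => ((Equiv.piSplitAt k fun l => Fin (p l)).symm (a, b)) l) = M a b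
  rw [h1, h2]

/-- Tucker rank: the tuple of the ranks of all matricizations. -/
def tucrank {N : ℕ} {p : Fin N → ℕ} (A : Tensor p) : Fin N → ℕ := fun k => (matricize k A).rank

/-- The product `A ×₁ B₁ ×₂ ⋯ ×_N B_N` of a tensor with one matrix along every mode:
entry `j` is the sum over `i` of `A i * ∏ k, B k (j k) (i k)`. -/
def modeProd {N : ℕ} {q p : Fin N → ℕ} (A : Tensor q)
    (B : ∀ k, Matrix (Fin (p k)) (Fin (q k)) ℝ) : Tensor p :=
  fun j => ∑ i, A i * ∏ k, B k (j k) (i k)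

/-- Kronecker product of the matrices `U l` over all modes `l ≠ k`. -/
def kronExcept {N : ℕ} {p q : Fin N → ℕ} (U : ∀ l, Matrix (Fin (p l)) (Fin (q l)) ℝ)
    (k : Fin N) : Matrix (OtherIdx p k) (OtherIdx q k) ℝ :=
  Matrix.of fun i j => ∏ l : {l : Fin N // l ≠ k}, U l (i l) (j l)

/-- `P_U = U Uᵀ`, for a matrix `U` with orthonormal columns. -/
def projMat {m n : Type*} [Fintype n] (U : Matrix m n ℝ) : Matrix m m ℝ := U * Uᵀ

/-- A Tucker decomposition `X = S ×₁ U₁ ⋯ ×_N U_N` with core `S` of size `r`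
and orthonormal factors `U k`, together with matrices `V k` with orthonormal columns such that
`(matricize k S)ᵀ = V k * R k` for a square matrix `R k` (for example a QR factorization). When
`X` has Tucker rank `r`, the columns of `V k` form an orthonormal basis of the row space of
`matricize k S`. -/
structure TuckerDecomp {N : ℕ} {p : Fin N → ℕ} (X : Tensor p) (r : Fin N → ℕ) where
  S : Tensor r
  U : ∀ k, Matrix (Fin (p k)) (Fin (r k)) ℝ
  orthU : ∀ k, (U k)ᵀ * U k = 1
  eq_modeProd : X = modeProd S U
  V : ∀ k, Matrix (OtherIdx r k) (Fin (r k)) ℝ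
  orthV : ∀ k, (V k)ᵀ * V k = 1
  qr : ∀ k, ∃ R : Matrix (Fin (r k)) (Fin (r k)) ℝ, (matricize k S)ᵀ = V k * R

/-- `W_k = (⨂_{l ≠ k} U_l) V_k`. -/
def TuckerDecomp.W {N : ℕ} {p r : Fin N → ℕ} {X : Tensor p} (D : TuckerDecomp X r) (k : Fin N) :
    Matrix (OtherIdx p k) (Fin (r k)) ℝ :=
  kronExcept D.U k * D.V k

/-- The projector onto the tangent space at `X` of the manifold of tensors of Tucker rank `r`:
`Z ×₁ P_{U₁} ⋯ ×_N P_{U_N} + ∑ k, T_k((I - P_{U_k}) M_k(Z) P_{W_k})`. -/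
def TuckerDecomp.tangentProj {N : ℕ} {p r : Fin N → ℕ} {X : Tensor p} (D : TuckerDecomp X r)
    (Z : Tensor p) : Tensor p :=
  modeProd Z (fun k => projMat (D.U k)) +
    ∑ k, tensorize k ((1 - projMat (D.U k)) * matricize k Z * projMat (D.W k))

/-- The complementary projector `I - P_T`. -/
def TuckerDecomp.tangentProjPerp {N : ℕ} {p r : Fin N → ℕ} {X : Tensor p} (D : TuckerDecomp X r)
    (Z : Tensor p) : Tensor p :=
  Z - D.tangentProj Z

/-- The `k`-th largest singular value, for `k ≥ 1` (Mathlib counts them from `0`). -/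
def sigma {m n : Type*} [Fintype m] [Fintype n] [DecidableEq n] (k : ℕ) (M : Matrix m n ℝ) : ℝ :=
  (Matrix.toEuclideanLin M).singularValues (k - 1)

/-- The minimum over the modes `k` of the `r k`-th singular value of the mode-`k`
matricization. -/
def lambdaMin {N : ℕ} {p : Fin N → ℕ} (X : Tensor p) (r : Fin N → ℕ) : ℝ :=
  ⨅ k, sigma (r k) (matricize k X)

/-- A matrix seen as a tensor of order two. -/
def ofMatrix {p₁ p₂ : ℕ} (X : Matrix (Fin p₁) (Fin p₂) ℝ) : Tensor ![p₁, p₂] :=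
  fun i => X (i 0) (i 1)

end

end TuckerProj

open TuckerProj

/-! Fix a mode `k` and let `A`, `B` be the mode-`k` matricizations of `X^t`, `X^*`. The projectors
`P = 1 - P_{U_k}` and `Q = 1 - P_{W_k}` satisfy `P A = 0` and `A Q = 0`. If `B G B = B`, then `P B Q
= P (B - A) G (B - A) Q`, which is quadratic in the error; taking for `G` the Moore-Penrose inverse
costs the factor `1 / σ_r(B)`, `r` being the rank of `B` (`norm_mul_mul_le_of_annihilates`,
`hasBoundedGenInverse_inv_sigma`).

The normal component of `X^*` is a sum of one such term per mode. Telescoping `Z - Z ×₁ P_{U₁} ⋯ ×_N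
P_{U_N}` gives terms with matricization `P M_k(Z) K`, where the projector `K` fixes the columns of
`W_k`; subtracting the `k`-th tangent term leaves `P M_k(Z) Q K` (`tangentProjPerp_eq_sum`). Since
`K` is a contraction, the constant is the order `N` of the tensor: half the claimed constant in
general, and exactly 2 for matrices. -/

namespace TuckerProj

/-! ### Frobenius norms and bounded generalized inverses -/

section MatrixBounds

open scoped Matrix.Norms.Frobenius

variable {l m n o : Type*} [Fintype l] [Fintype m] [Fintype n] [Fintype o]

theorem frobenius_norm_sq (M : Matrix m n ℝ) : ‖M‖ ^ 2 = ∑ i, ∑ j, M i j ^ 2 := by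
  rw [Matrix.frobenius_norm_def, ← Real.sqrt_eq_rpow, Real.sq_sqrt (by positivity)]
  simp

theorem frobenius_norm_eq_sqrt (M : Matrix m n ℝ) : ‖M‖ = √(∑ i, ∑ j, M i j ^ 2) := by
  rw [← frobenius_norm_sq, Real.sqrt_sq (norm_nonneg _)]

theorem frobenius_norm_sq_eq_trace (M : Matrix m n ℝ) : ‖M‖ ^ 2 = (Mᵀ * M).trace := by
  rw [frobenius_norm_sq, Finset.sum_comm]
  simp [Matrix.trace, Matrix.mul_apply, sq]

theorem frobenius_norm_congr {M : Matrix m n ℝ} {M' : Matrix l n ℝ} (h : Mᵀ * M = M'ᵀ * M') :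
    ‖M‖ = ‖M'‖ := by
  rw [← sq_eq_sq₀ (norm_nonneg _) (norm_nonneg _), frobenius_norm_sq_eq_trace, h,
    ← frobenius_norm_sq_eq_trace]

theorem frobenius_norm_submatrix (M : Matrix m n ℝ) (e : l ≃ m) (f : o ≃ n) :
    ‖M.submatrix e f‖ = ‖M‖ := by
  rw [frobenius_norm_eq_sqrt, frobenius_norm_eq_sqrt]
  congr 1
  rw [← e.sum_comp]
  refine Finset.sum_congr rfl fun i _ => ?_
  rw [← f.sum_comp]
  rfl

/-- An orthogonal projector is a contraction for the Frobenius norm. -/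
theorem norm_proj_mul_le {P : Matrix m m ℝ} (hs : Pᵀ = P) (hi : P * P = P)
    (M : Matrix m n ℝ) : ‖P * M‖ ≤ ‖M‖ := by
  classical
  have h : ‖M‖ ^ 2 = ‖P * M‖ ^ 2 + ‖(1 - P) * M‖ ^ 2 := by
    simp only [frobenius_norm_sq_eq_trace, ← Matrix.trace_add]
    congr 1
    simp only [Matrix.transpose_mul, Matrix.transpose_sub, Matrix.transpose_one, hs]
    have h1 : Mᵀ * P * (P * M) = Mᵀ * (P * M) := by
      rw [Matrix.mul_assoc, ← Matrix.mul_assoc P P, hi]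
    have h2 : (1 - P) * ((1 - P) * M) = M - P * M := by
      rw [← Matrix.mul_assoc, mul_sub, sub_mul, sub_mul, hi]
      simp [Matrix.sub_mul]
    rw [h1, Matrix.mul_assoc Mᵀ (1 - P), h2, Matrix.mul_sub]
    abel
  nlinarith [norm_nonneg (P * M), norm_nonneg M, sq_nonneg ‖(1 - P) * M‖]

theorem norm_mul_proj_le {P : Matrix n n ℝ} (hs : Pᵀ = P) (hi : P * P = P)
    (M : Matrix m n ℝ) : ‖M * P‖ ≤ ‖M‖ := by
  have h := norm_proj_mul_le hs hi Mᵀ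
  rwa [← Matrix.frobenius_norm_transpose, Matrix.transpose_mul, hs,
    ← Matrix.frobenius_norm_transpose M]

theorem projMat_transpose {m : Type*} (U : Matrix m n ℝ) : (projMat U)ᵀ = projMat U := by
  simp [projMat]

theorem projMat_mul_self [DecidableEq n] {U : Matrix m n ℝ} (h : Uᵀ * U = 1) :
    projMat U * U = U := by
  rw [projMat, Matrix.mul_assoc, h, Matrix.mul_one]

theorem projMat_mul_projMat [DecidableEq n] {U : Matrix m n ℝ} (h : Uᵀ * U = 1) :
    projMat U * projMat U = projMat U := by
  conv_lhs => rw [projMat.eq_def U, ← Matrix.mul_assoc, ← projMat.eq_def U, projMat_mul_self h]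
  rfl

/-- `B` has a generalized inverse `G` of operator norm at most `c`; the norm bound is expressed
through its effect on Frobenius norms. -/
def HasBoundedGenInverse (B : Matrix m n ℝ) (c : ℝ) : Prop :=
  ∃ G : Matrix n m ℝ, B * G * B = B ∧ ∀ L R : Matrix m n ℝ, ‖L * G * R‖ ≤ c * (‖L‖ * ‖R‖)

theorem HasBoundedGenInverse.transpose {B : Matrix m n ℝ} {c : ℝ}
    (h : HasBoundedGenInverse B c) : HasBoundedGenInverse Bᵀ c := by
  obtain ⟨G, hG, hb⟩ := h
  refine ⟨Gᵀ, ?_, fun L R => ?_⟩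
  · rw [← Matrix.transpose_mul, ← Matrix.transpose_mul, ← Matrix.mul_assoc, hG]
  · have h := hb Rᵀ Lᵀ
    rw [← Matrix.frobenius_norm_transpose, Matrix.frobenius_norm_transpose R,
      Matrix.frobenius_norm_transpose L] at h
    simpa [Matrix.transpose_mul, Matrix.mul_assoc, mul_comm ‖R‖] using h

theorem HasBoundedGenInverse.submatrix {B : Matrix m n ℝ} {c : ℝ}
    (h : HasBoundedGenInverse B c) (e : l ≃ m) (f : o ≃ n) :
    HasBoundedGenInverse (B.submatrix e f) c := by
  obtain ⟨G, hG, hb⟩ := h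
  refine ⟨G.submatrix f e, ?_, fun L R => ?_⟩
  · rw [Matrix.submatrix_mul_equiv, Matrix.submatrix_mul_equiv, hG]
  · have h := hb (L.submatrix e.symm f.symm) (R.submatrix e.symm f.symm)
    rw [frobenius_norm_submatrix, frobenius_norm_submatrix] at h
    convert h using 1
    rw [← frobenius_norm_submatrix (_ * G * _) e f, ← Matrix.submatrix_mul_equiv _ _ e e f,
      ← Matrix.submatrix_mul_equiv _ _ e f e]
    simp

theorem HasBoundedGenInverse.mono {B : Matrix m n ℝ} {c c' : ℝ} (h : HasBoundedGenInverse B c)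
    (hc : c ≤ c') : HasBoundedGenInverse B c' := by
  obtain ⟨G, hG, hb⟩ := h
  exact ⟨G, hG, fun L R => (hb L R).trans (by gcongr)⟩

/-- The generalized inverse is read off a singular value decomposition: `U = B V D` holds the left
singular vectors, and `G = V D Uᵀ`. Zero singular values need no separate treatment, because `0⁻¹ =
0` makes `D` the pseudo-inverse of the diagonal factor. -/
theorem hasBoundedGenInverse_of_diagonalization [DecidableEq n] [DecidableEq l] {B : Matrix m n ℝ}
    {c : ℝ} {V : Matrix n l ℝ} {s : l → ℝ} (hV : Vᵀ * V = 1) (hV' : V * Vᵀ = 1)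
    (hB : Bᵀ * B * V = V * Matrix.diagonal (fun i => s i ^ 2)) (hs : ∀ i, |(s i)⁻¹| ≤ c)
    (hc : 0 ≤ c) : HasBoundedGenInverse B c := by
  set D : Matrix l l ℝ := Matrix.diagonal fun i => (s i)⁻¹ with hD
  set S : Matrix l l ℝ := Matrix.diagonal (fun i => s i ^ 2) with hS
  have hDt : Dᵀ = D := Matrix.diagonal_transpose _
  have hBV : (B * V)ᵀ * (B * V) = S := by
    rw [Matrix.transpose_mul, Matrix.mul_assoc, ← Matrix.mul_assoc Bᵀ, hB, ← Matrix.mul_assoc, hV,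
      Matrix.one_mul]
  have hDSD : ∀ i, (s i)⁻¹ * (s i ^ 2 * (s i)⁻¹) * (s i)⁻¹ = (s i)⁻¹ := fun i => by
    rcases eq_or_ne (s i) 0 with h | h
    · simp [h]
    · field_simp
  set U := B * V * D with hU
  have hUU : Uᵀ * U = D * (S * D) := by
    rw [hU, Matrix.transpose_mul, hDt, Matrix.mul_assoc, ← Matrix.mul_assoc _ (B * V), hBV]
  -- `U` is only a partial isometry: its columns with `s i = 0` vanish.
  have hUUU : U * (Uᵀ * U) = U := by
    rw [hUU, hU, Matrix.mul_assoc (B * V)]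
    congr 1
    rw [hD, hS]
    simp only [Matrix.diagonal_mul_diagonal]
    congr 1
    funext i
    rw [← hDSD i]
    ring_nf
    rcases eq_or_ne (s i) 0 with h | h
    · simp [h]
    · field_simp
  refine ⟨V * D * Uᵀ, ?_, fun L R => ?_⟩
  -- `D * (D * S)` is the indicator of `s i ≠ 0`. The remaining columns of `B * V` vanish because
  -- their Gram matrix does.
  · have hE : B * V * (1 - D * (D * S)) = 0 := by
      rw [← Matrix.conjTranspose_mul_self_eq_zero, Matrix.conjTranspose_eq_transpose_of_trivial,
        Matrix.transpose_mul, Matrix.mul_assoc, ← Matrix.mul_assoc _ (B * V), hBV, hD, hS,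
        Matrix.diagonal_mul_diagonal, Matrix.diagonal_mul_diagonal, ← Matrix.diagonal_one,
        Matrix.diagonal_sub, Matrix.diagonal_mul_diagonal, Matrix.diagonal_transpose,
        Matrix.diagonal_mul_diagonal, ← Matrix.diagonal_zero]
      congr 1
      funext i
      rcases eq_or_ne (s i) 0 with h | h
      · simp [h]
      · field_simp
        simp
    have h1 : Uᵀ * B = D * S * Vᵀ := by
      have h2 : Uᵀ * B * V = D * S := by
        rw [hU, Matrix.transpose_mul, hDt, Matrix.mul_assoc, Matrix.mul_assoc, hBV]
      rw [← h2, Matrix.mul_assoc _ V, hV', Matrix.mul_one]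
    have h3 : B * (V * D * Uᵀ) * B = B * V * (D * (D * S)) * Vᵀ := by
      rw [Matrix.mul_assoc B, Matrix.mul_assoc (V * D), h1]
      simp only [Matrix.mul_assoc]
    rw [Matrix.mul_sub, Matrix.mul_one, sub_eq_zero] at hE
    rw [h3, ← hE, Matrix.mul_assoc, hV', Matrix.mul_one]
  · have h1 : ‖L * V‖ = ‖L‖ := by
      rw [← Matrix.frobenius_norm_transpose, ← Matrix.frobenius_norm_transpose L]
      apply frobenius_norm_congr
      rw [Matrix.transpose_transpose, Matrix.transpose_transpose, Matrix.transpose_mul,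
        Matrix.mul_assoc, ← Matrix.mul_assoc V, hV', Matrix.one_mul]
    have h2 : ‖L * V * D‖ ≤ c * ‖L‖ := by
      rw [← h1, ← abs_of_nonneg hc, ← Real.norm_eq_abs, ← norm_smul, frobenius_norm_eq_sqrt,
        frobenius_norm_eq_sqrt]
      refine Real.sqrt_le_sqrt (Finset.sum_le_sum fun i _ => Finset.sum_le_sum fun j _ => ?_)
      rw [hD, Matrix.mul_diagonal, Matrix.smul_apply, smul_eq_mul, mul_pow, mul_pow, mul_comm]
      refine mul_le_mul_of_nonneg_right ?_ (sq_nonneg _)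
      rw [← sq_abs]
      exact pow_le_pow_left₀ (abs_nonneg _) (hs j) 2
    have h3 : ‖Uᵀ * R‖ ≤ ‖R‖ := by
      -- This replaces `Uᵀ` by the orthogonal projector `U * Uᵀ`, which is a contraction.
      have h4 : ‖Uᵀ * R‖ = ‖U * Uᵀ * R‖ := by
        apply frobenius_norm_congr
        simp only [Matrix.transpose_mul, Matrix.transpose_transpose]
        have h5 : U * (Uᵀ * (U * (Uᵀ * R))) = U * (Uᵀ * R) := by
          rw [← Matrix.mul_assoc Uᵀ U, ← Matrix.mul_assoc, hUUU]
        simp only [Matrix.mul_assoc, h5]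
      rw [h4]
      refine norm_proj_mul_le (by simp) ?_ R
      rw [← Matrix.mul_assoc, Matrix.mul_assoc U, hUUU]
    calc ‖L * (V * D * Uᵀ) * R‖ = ‖(L * V * D) * (Uᵀ * R)‖ := by simp only [Matrix.mul_assoc]
      _ ≤ ‖L * V * D‖ * ‖Uᵀ * R‖ := Matrix.frobenius_norm_mul _ _
      _ ≤ (c * ‖L‖) * ‖R‖ := by gcongr
      _ = _ := by ring

theorem rank_eq_finrank_range_toEuclideanLin [DecidableEq n] (B : Matrix m n ℝ) :
    Module.finrank ℝ (LinearMap.range (Matrix.toEuclideanLin B)) = B.rank := by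
  
  rw [Matrix.rank_eq_finrank_range_toLin B (PiLp.basisFun 2 ℝ m) (PiLp.basisFun 2 ℝ n),
    ← Matrix.toLpLin_eq_toLin]

theorem sigma_rank_pos [DecidableEq n] {B : Matrix m n ℝ} (h : 1 ≤ B.rank) :
    0 < sigma B.rank B := by
  rw [sigma, LinearMap.singularValues_pos_iff_lt_finrank_range,
    rank_eq_finrank_range_toEuclideanLin]
  omega

/-- The Moore-Penrose inverse of `B` has operator norm `1 / σ_r(B)`, where `r` is the rank. -/
theorem hasBoundedGenInverse_inv_sigma [DecidableEq n] (B : Matrix m n ℝ) :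
    HasBoundedGenInverse B (sigma B.rank B)⁻¹ := by
  set T := Matrix.toEuclideanLin B with hT
  have hsym := T.isSymmetric_adjoint_comp_self
  set b := hsym.eigenvectorBasis rfl with hb
  set V : Matrix n (Fin (Module.finrank ℝ (EuclideanSpace ℝ n))) ℝ := Matrix.of fun j i => b i j
  have hV : Vᵀ * V = 1 := by
    ext i j
    have := (orthonormal_iff_ite.1 b.orthonormal) i j
    rw [Matrix.one_apply, ← this, PiLp.inner_apply]
    simp [V, Matrix.mul_apply, mul_comm]
  have hV' : V * Vᵀ = 1 := by
    have hcard : Fintype.card (Fin (Module.finrank ℝ (EuclideanSpace ℝ n))) = Fintype.card n := by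
      simp
    exact (Matrix.mul_eq_one_comm_of_card_eq _ _ _ hcard.symm).2 hV
  refine hasBoundedGenInverse_of_diagonalization (s := fun i : Fin _ => T.singularValues i) hV hV' ?_ ?_
    (inv_nonneg.2 (LinearMap.singularValues_nonneg _ _))
  · ext j i
    classical
    have hadj : LinearMap.adjoint T (T (b i)) = Matrix.toEuclideanLin Bᵀ (T (b i)) :=
      congrArg (fun S : _ →ₗ[ℝ] _ => S (T (b i)))
        (Matrix.toEuclideanLin_conjTranspose_eq_adjoint B).symm
    have h1 := hadj.symm.trans (hsym.apply_eigenvectorBasis rfl i)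
    have h2 : (Bᵀ *ᵥ (B *ᵥ (b i).ofLp)) j = hsym.eigenvalues rfl i * b i j :=
      congrArg (fun v : EuclideanSpace ℝ n => v j) h1
    rw [Matrix.mul_diagonal, LinearMap.sq_singularValues_fin T rfl, Matrix.mul_assoc,
      mul_comm (V j i)]
    exact h2
  · intro i
    rw [abs_of_nonneg (inv_nonneg.2 (LinearMap.singularValues_nonneg _ _))]
    rcases (T.singularValues_nonneg i).eq_or_lt with h | h
    · rw [← h, inv_zero]
      exact inv_nonneg.2 (LinearMap.singularValues_nonneg _ _)
    -- A positive singular value has zero-based index at most `B.rank - 1`, the index of `sigma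
    -- B.rank B`, so it is at least that value.
    · have hi := h
      rw [LinearMap.singularValues_pos_iff_lt_finrank_range,
        rank_eq_finrank_range_toEuclideanLin] at hi
      exact inv_anti₀ (sigma_rank_pos (by omega)) (T.singularValues_antitone (by omega))

/-- If the column and row spaces of `A` are annihilated by the contractions `P` and `Q`, then
`P B Q` is quadratically small in `B - A`. -/
theorem norm_mul_mul_le_of_annihilates {A B : Matrix m n ℝ} {c : ℝ} (hB : HasBoundedGenInverse B c)
    (hc : 0 ≤ c) {P : Matrix m m ℝ} {Q : Matrix n n ℝ} (hP : Pᵀ = P) (hPP : P * P = P)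
    (hQ : Qᵀ = Q) (hQQ : Q * Q = Q) (hPA : P * A = 0) (hAQ : A * Q = 0) :
    ‖P * B * Q‖ ≤ c * ‖A - B‖ ^ 2 := by
  obtain ⟨G, hG, hb⟩ := hB
  -- Write `B` as `B * G * B`; then `A` can be subtracted from each outer copy at no cost.
  have h : P * B * Q = (P * (B - A)) * G * ((B - A) * Q) := by
    rw [Matrix.mul_sub, hPA, sub_zero, Matrix.sub_mul, hAQ, sub_zero]
    conv_lhs => rw [← hG]
    simp only [Matrix.mul_assoc]
  rw [h]
  refine (hb _ _).trans (mul_le_mul_of_nonneg_left ?_ hc)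
  rw [sq, norm_sub_rev]
  exact mul_le_mul (norm_proj_mul_le hP hPP _) (norm_mul_proj_le hQ hQQ _) (norm_nonneg _)
    (norm_nonneg _)

end MatrixBounds

/-- A matrix of rank `r` has an orthonormal basis of its column space, of size `r`. -/
theorem exists_orthonormal_projMat_mul_eq {m n : Type*} [Fintype m] [Fintype n]
    (A : Matrix m n ℝ) {r : ℕ} (hr : A.rank = r) :
    ∃ U : Matrix m (Fin r) ℝ, Uᵀ * U = 1 ∧ projMat U * A = A := by
  classical
  set R := LinearMap.range (Matrix.toEuclideanLin A) with hR
  have hfr : Module.finrank ℝ R = r := by rw [hR, rank_eq_finrank_range_toEuclideanLin, hr]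
  let b : OrthonormalBasis (Fin r) ℝ R := (stdOrthonormalBasis ℝ R).reindex (finCongr hfr)
  refine ⟨Matrix.of fun i j => (b j : EuclideanSpace ℝ m) i, ?_, ?_⟩
  · ext i j
    have := (orthonormal_iff_ite.1 b.orthonormal) i j
    rw [Matrix.one_apply, ← this, Submodule.coe_inner, PiLp.inner_apply, Matrix.mul_apply]
    exact Finset.sum_congr rfl fun k _ => by simp [mul_comm]
  · set U : Matrix m (Fin r) ℝ := Matrix.of fun i j => (b j : EuclideanSpace ℝ m) i
    ext i j
    let x : R := ⟨Matrix.toEuclideanLin A (EuclideanSpace.single j 1), LinearMap.mem_range_self _ _⟩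
    have hx : ∀ i, (x : EuclideanSpace ℝ m) i = A i j := fun i => by
      simp [x]
    have h := congrArg (fun v : R => (v : EuclideanSpace ℝ m) i) (b.sum_repr' x)
    simp only [hx, Submodule.coe_inner, PiLp.inner_apply] at h
    rw [← h, projMat, Matrix.mul_assoc, Matrix.mul_apply, Submodule.coe_sum, WithLp.ofLp_sum,
      Finset.sum_apply]
    refine Finset.sum_congr rfl fun k _ => ?_
    rw [mul_comm, Matrix.mul_apply]
    change _ = (∑ i, _) * U i k
    congr 1
    refine Finset.sum_congr rfl fun l _ => ?_
    simp [U, mul_comm]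


/-! ### Mode products, telescoping and existence of Tucker decompositions -/

section Tensors

variable {N : ℕ} {p q s : Fin N → ℕ}

theorem kronExcept_mul (A : ∀ l, Matrix (Fin (p l)) (Fin (q l)) ℝ)
    (B : ∀ l, Matrix (Fin (q l)) (Fin (s l)) ℝ) (k : Fin N) :
    kronExcept A k * kronExcept B k = kronExcept (fun l => A l * B l) k := by
  ext i j
  simp only [Matrix.mul_apply, kronExcept, Matrix.of_apply, ← Finset.prod_mul_distrib]
  exact (Fintype.prod_sum fun (l : {l : Fin N // l ≠ k}) x => A l (i l) x * B l x (j l)).symm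

theorem kronExcept_transpose (A : ∀ l, Matrix (Fin (p l)) (Fin (q l)) ℝ) (k : Fin N) :
    (kronExcept A k)ᵀ = kronExcept (fun l => (A l)ᵀ) k := rfl

theorem kronExcept_congr {A B : ∀ l, Matrix (Fin (p l)) (Fin (q l)) ℝ} {k : Fin N}
    (h : ∀ l, l ≠ k → A l = B l) : kronExcept A k = kronExcept B k := by
  ext i j
  rw [kronExcept, kronExcept, Matrix.of_apply, Matrix.of_apply]
  exact Finset.prod_congr rfl fun l _ => by rw [h l.1 l.2]

theorem kronExcept_one (k : Fin N) :
    kronExcept (fun l => (1 : Matrix (Fin (p l)) (Fin (p l)) ℝ)) k = 1 := by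
  ext i j
  simp only [kronExcept, Matrix.of_apply, Matrix.one_apply, Finset.prod_ite_zero, funext_iff]
  simp

theorem matricize_modeProd (A : Tensor q) (B : ∀ k, Matrix (Fin (p k)) (Fin (q k)) ℝ)
    (k : Fin N) :
    matricize k (modeProd A B) = B k * matricize k A * (kronExcept B k)ᵀ := by
  ext a b
  rw [Matrix.mul_apply, matricize, Matrix.of_apply, modeProd,
    ← (Equiv.piSplitAt k fun l => Fin (q l)).symm.sum_comp, Fintype.sum_prod_type_right]
  refine Finset.sum_congr rfl fun b' _ => ?_
  rw [Matrix.mul_apply, Finset.sum_mul]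
  refine Finset.sum_congr rfl fun a' _ => ?_
  rw [Fintype.prod_eq_mul_prod_subtype_ne _ k]
  have h (q : Fin N → ℕ) (a : Fin (q k)) (b : OtherIdx q k) :
      (Equiv.piSplitAt k fun l => Fin (q l)).symm (a, b) k = a := by simp [Equiv.piSplitAt]
  have h' (q : Fin N → ℕ) (a : Fin (q k)) (b : OtherIdx q k) (l : {l : Fin N // l ≠ k}) :
      (Equiv.piSplitAt k fun l => Fin (q l)).symm (a, b) l = b l := by
    simp [Equiv.piSplitAt, l.2]
  simp only [h, h', matricize, kronExcept, Matrix.of_apply, Matrix.transpose_apply]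
  ring

/-- The `k`-th term of the telescoping expansion of `Z - Z ×₁ P₁ ⋯ ×_N P_N` is the product of `Z`
with these matrices. -/
def telescopeFactor (P : ∀ k, Matrix (Fin (p k)) (Fin (p k)) ℝ) (k l : Fin N) :
    Matrix (Fin (p l)) (Fin (p l)) ℝ :=
  if l < k then P l else if k < l then 1 else 1 - P l

theorem telescopeFactor_self (P : ∀ k, Matrix (Fin (p k)) (Fin (p k)) ℝ) (k : Fin N) :
    telescopeFactor P k k = 1 - P k := by
  simp [telescopeFactor]

theorem sub_modeProd (Z : Tensor p) (P : ∀ k, Matrix (Fin (p k)) (Fin (p k)) ℝ) :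
    Z - modeProd Z P = ∑ k, modeProd Z (telescopeFactor P k) := by
  have h1 (j i : ∀ k, Fin (p k)) : (if j = i then (1 : ℝ) else 0) - ∏ k, P k (j k) (i k) =
      ∑ k, ∏ l, telescopeFactor P k l (j l) (i l) := by
    -- Expand `∏ P` with each factor written as `1 + (P - 1)`: the `k`-th term keeps `P` before `k`
    -- and `1` after it.
    have h := Finset.prod_add_ordered Finset.univ
      (fun k => (1 : Matrix (Fin (p k)) (Fin (p k)) ℝ) (j k) (i k))
      (fun k => P k (j k) (i k) - (1 : Matrix (Fin (p k)) (Fin (p k)) ℝ) (j k) (i k))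
    have h2 : ∏ k, (1 : Matrix (Fin (p k)) (Fin (p k)) ℝ) (j k) (i k) = if j = i then 1 else 0 := by
      simp only [Matrix.one_apply, Finset.prod_ite_zero, funext_iff]
      simp
    simp only [add_sub_cancel, h2] at h
    rw [h, sub_add_cancel_left, ← Finset.sum_neg_distrib]
    refine Finset.sum_congr rfl fun k _ => ?_
    have h3 : ∏ l, telescopeFactor P k l (j l) (i l) = telescopeFactor P k k (j k) (i k) *
        ((∏ l with l < k, telescopeFactor P k l (j l) (i l)) *
          ∏ l with k < l, telescopeFactor P k l (j l) (i l)) := by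
      rw [← Finset.mul_prod_erase _ _ (Finset.mem_univ k), ← Finset.prod_union]
      · congr 2
        ext l
        simp [lt_or_lt_iff_ne]
      · exact Finset.disjoint_filter.2 fun l _ h => h.le.not_gt
    have h4 : ∏ l with l < k, telescopeFactor P k l (j l) (i l) =
        ∏ l with l < k, P l (j l) (i l) :=
      Finset.prod_congr rfl fun l hl => by simp [telescopeFactor, (Finset.mem_filter.1 hl).2]
    have h5 : ∏ l with k < l, telescopeFactor P k l (j l) (i l) =
        ∏ l with k < l, (1 : Matrix (Fin (p l)) (Fin (p l)) ℝ) (j l) (i l) :=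
      Finset.prod_congr rfl fun l hl => by
        have := (Finset.mem_filter.1 hl).2
        simp [telescopeFactor, this, this.not_gt]
    rw [h3, h4, h5, telescopeFactor_self, Matrix.sub_apply]
    ring
  funext j
  simp only [Pi.sub_apply, Finset.sum_apply, modeProd]
  rw [Finset.sum_comm]
  simp only [← Finset.mul_sum, ← h1, mul_sub, Finset.sum_sub_distrib]
  simp

theorem matricize_sub (A B : Tensor p) (k : Fin N) :
    matricize k (A - B) = matricize k A - matricize k B := rfl

theorem frobNorm_sum_le {ι : Type*} (t : Finset ι) (A : ι → Tensor p) :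
    frobNorm (∑ k ∈ t, A k) ≤ ∑ k ∈ t, frobNorm (A k) := by
  have h (A : Tensor p) : frobNorm A = ‖WithLp.toLp 2 A‖ := by
    simp [frobNorm, EuclideanSpace.norm_eq]
  simp only [h, WithLp.toLp_sum]
  exact norm_sum_le _ _

theorem isIdempotent_telescopeFactor {U : ∀ k, Matrix (Fin (p k)) (Fin (q k)) ℝ}
    (hU : ∀ k, (U k)ᵀ * U k = 1) (k l : Fin N) :
    telescopeFactor (fun l => projMat (U l)) k l * telescopeFactor (fun l => projMat (U l)) k l =
      telescopeFactor (fun l => projMat (U l)) k l := by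
  unfold telescopeFactor
  have h := projMat_mul_projMat (hU l)
  split_ifs
  · exact h
  · simp
  · simp [sub_mul, mul_sub, h]

theorem telescopeFactor_transpose (U : ∀ k, Matrix (Fin (p k)) (Fin (q k)) ℝ) (k l : Fin N) :
    (telescopeFactor (fun l => projMat (U l)) k l)ᵀ =
      telescopeFactor (fun l => projMat (U l)) k l := by
  unfold telescopeFactor
  split_ifs <;> simp [projMat_transpose]

theorem telescopeFactor_mul {U : ∀ k, Matrix (Fin (p k)) (Fin (q k)) ℝ}
    (hU : ∀ k, (U k)ᵀ * U k = 1) {k l : Fin N} (h : l ≠ k) :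
    telescopeFactor (fun l => projMat (U l)) k l * U l = U l := by
  unfold telescopeFactor
  rcases lt_or_gt_of_ne h with h | h
  · simp [h, projMat_mul_self (hU l)]
  · simp [h, h.not_gt]

/-- Each telescoping term contains a factor `1 - P_{U_k}` acting on mode `k`, which kills `A`. -/
theorem modeProd_projMat_eq_self {A : Tensor p} {U : ∀ k, Matrix (Fin (p k)) (Fin (q k)) ℝ}
    (h : ∀ k, projMat (U k) * matricize k A = matricize k A) :
    modeProd A (fun k => projMat (U k)) = A := by
  refine (sub_eq_zero.1 ?_).symm
  rw [sub_modeProd]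
  refine Finset.sum_eq_zero fun k _ => ?_
  rw [← tensorize_matricize k (modeProd A _), matricize_modeProd, telescopeFactor_self,
    Matrix.sub_mul, h, Matrix.one_mul, sub_self, Matrix.zero_mul]
  rfl

theorem modeProd_modeProd (A : Tensor q) (B : ∀ k, Matrix (Fin (p k)) (Fin (q k)) ℝ)
    (C : ∀ k, Matrix (Fin (s k)) (Fin (p k)) ℝ) :
    modeProd (modeProd A B) C = modeProd A (fun k => C k * B k) := by
  funext j
  simp only [modeProd, Matrix.mul_apply, Finset.sum_mul]
  rw [Finset.sum_comm]
  refine Finset.sum_congr rfl fun i _ => ?_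
  rw [Fintype.prod_sum, Finset.mul_sum]
  refine Finset.sum_congr rfl fun x _ => ?_
  rw [mul_assoc, ← Finset.prod_mul_distrib]
  simp only [mul_comm]

theorem nonempty_tuckerDecomp {X : Tensor p} {r : Fin N → ℕ} (hX : tucrank X = r) :
    Nonempty (TuckerDecomp X r) := by
  have hr (k : Fin N) : (matricize k X).rank = r k := congrFun hX k
  choose U hU hUX using fun k => exists_orthonormal_projMat_mul_eq (matricize k X) (hr k)
  set S : Tensor r := modeProd X fun k => (U k)ᵀ with hS
  have hXS : X = modeProd S U := by
    rw [hS, modeProd_modeProd]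
    exact (modeProd_projMat_eq_self hUX).symm
  -- The core has full rank in every mode: at most `r k` by its number of rows, at least `r k`
  -- because the matricization of `X` factors through that of `S`.
  have hSr (k : Fin N) : ((matricize k S)ᵀ).rank = r k := by
    rw [Matrix.rank_transpose]
    refine le_antisymm ((Matrix.rank_le_card_height _).trans_eq (by simp)) ?_
    refine (hr k).symm.trans_le ?_
    rw [hXS, matricize_modeProd]
    exact (Matrix.rank_mul_le_left _ _).trans (Matrix.rank_mul_le_right _ _)
  choose V hV hVS using fun k => exists_orthonormal_projMat_mul_eq (matricize k S)ᵀ (hSr k)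
  exact ⟨⟨S, U, hU, hXS, V, hV, fun k => ⟨(V k)ᵀ * (matricize k S)ᵀ, by
    rw [← Matrix.mul_assoc, ← projMat, hVS]⟩⟩⟩

/-! ### The normal component and its quadratic bound -/

namespace TuckerDecomp

variable {X : Tensor p} {r : Fin N → ℕ} (D : TuckerDecomp X r)

theorem matricize_eq (k : Fin N) :
    matricize k X = D.U k * matricize k D.S * (kronExcept D.U k)ᵀ :=
  (congrArg (matricize k) D.eq_modeProd).trans (matricize_modeProd _ _ _)

theorem transpose_W_mul_W (k : Fin N) : (D.W k)ᵀ * D.W k = 1 := by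
  rw [W, Matrix.transpose_mul, Matrix.mul_assoc, ← Matrix.mul_assoc (kronExcept D.U k)ᵀ,
    kronExcept_transpose, kronExcept_mul]
  simp only [D.orthU]
  rw [kronExcept_one, Matrix.one_mul, D.orthV]

theorem one_sub_projMat_U_mul_matricize (k : Fin N) :
    (1 - projMat (D.U k)) * matricize k X = 0 := by
  rw [D.matricize_eq, Matrix.mul_assoc, ← Matrix.mul_assoc, Matrix.sub_mul,
    projMat_mul_self (D.orthU k), Matrix.one_mul, sub_self, Matrix.zero_mul]

/-- The factorization `(matricize k S)ᵀ = V k * R` puts the row space of `matricize k X` inside the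
column span of `W k`. -/
theorem matricize_mul_one_sub_projMat_W (k : Fin N) :
    matricize k X * (1 - projMat (D.W k)) = 0 := by
  obtain ⟨R, hR⟩ := D.qr k
  have h : matricize k X = D.U k * Rᵀ * (D.W k)ᵀ := by
    rw [D.matricize_eq, ← Matrix.transpose_transpose (matricize k D.S), hR, W,
      Matrix.transpose_mul, Matrix.transpose_mul]
    simp only [Matrix.mul_assoc]
  have h' : (D.W k)ᵀ * projMat (D.W k) = (D.W k)ᵀ := by
    rw [projMat, ← Matrix.mul_assoc, transpose_W_mul_W, Matrix.one_mul]
  rw [h, Matrix.mul_assoc, Matrix.mul_sub, Matrix.mul_one, h', sub_self, Matrix.mul_zero]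

theorem kronExcept_telescopeFactor_mul_projMat_W (k : Fin N) :
    kronExcept (telescopeFactor (fun l => projMat (D.U l)) k) k * projMat (D.W k) =
      projMat (D.W k) := by
  have h : kronExcept (telescopeFactor (fun l => projMat (D.U l)) k) k * D.W k = D.W k := by
    rw [W, ← Matrix.mul_assoc, kronExcept_mul,
      kronExcept_congr fun l hl => telescopeFactor_mul D.orthU hl]
  rw [projMat, ← Matrix.mul_assoc, h]

/-- Telescoping terms are paired with tangent terms mode by mode. As `P_W K = P_W`, the difference
`K - P_W` factors as `(1 - P_W) K`. -/
theorem tangentProjPerp_eq_sum (Z : Tensor p) :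
    D.tangentProjPerp Z = ∑ k, tensorize k ((1 - projMat (D.U k)) * matricize k Z *
      (1 - projMat (D.W k)) * kronExcept (telescopeFactor (fun l => projMat (D.U l)) k) k) := by
  rw [tangentProjPerp, tangentProj, ← sub_sub, sub_modeProd, ← Finset.sum_sub_distrib]
  refine Finset.sum_congr rfl fun k _ => ?_
  set K := kronExcept (telescopeFactor (fun l => projMat (D.U l)) k) k with hK
  have hKt : Kᵀ = K := by
    rw [hK, kronExcept_transpose]
    simp only [telescopeFactor_transpose]
  have hWK : projMat (D.W k) * K = projMat (D.W k) := by
    have h := congrArg Matrix.transpose (D.kronExcept_telescopeFactor_mul_projMat_W k)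
    rwa [Matrix.transpose_mul, projMat_transpose, ← hK, hKt] at h
  rw [← tensorize_matricize k (modeProd Z _), matricize_modeProd, telescopeFactor_self, ← hK, hKt,
    Matrix.mul_assoc _ (1 - projMat (D.W k)), Matrix.sub_mul 1 _ K, Matrix.one_mul, hWK,
    Matrix.mul_sub]
  rfl

section

open scoped Matrix.Norms.Frobenius

theorem frobNorm_eq_norm_matricize (A : Tensor p) (k : Fin N) : frobNorm A = ‖matricize k A‖ := by
  rw [frobenius_norm_eq_sqrt, frobNorm, ← (Equiv.piSplitAt k fun l => Fin (p l)).symm.sum_comp,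
    Fintype.sum_prod_type]
  rfl

/-- The tangent space at `X` misses a tensor `Z` by an error quadratic in `X - Z`. -/
theorem frobNorm_tangentProjPerp_le {Z : Tensor p} {c : ℝ} (hc : 0 ≤ c)
    (hZ : ∀ k, HasBoundedGenInverse (matricize k Z) c) :
    frobNorm (D.tangentProjPerp Z) ≤ N * (c * frobNorm (X - Z) ^ 2) := by
  rw [tangentProjPerp_eq_sum]
  refine (frobNorm_sum_le _ _).trans ?_
  refine (Finset.sum_le_card_nsmul _ _ (c * frobNorm (X - Z) ^ 2) fun k _ => ?_).trans
    (by simp)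
  rw [frobNorm_eq_norm_matricize _ k, matricize_tensorize, frobNorm_eq_norm_matricize _ k,
    matricize_sub]
  -- The trailing Kronecker factor is an orthogonal projector, so it can be dropped.
  refine (norm_mul_proj_le ?_ ?_ _).trans (norm_mul_mul_le_of_annihilates (hZ k) hc ?_ ?_ ?_ ?_
    (D.one_sub_projMat_U_mul_matricize k) (D.matricize_mul_one_sub_projMat_W k))
  · rw [kronExcept_transpose]
    simp only [telescopeFactor_transpose]
  · rw [kronExcept_mul]
    simp only [isIdempotent_telescopeFactor D.orthU]
  · simp [projMat_transpose]
  · simp [sub_mul, mul_sub, projMat_mul_projMat (D.orthU k)]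
  · simp [projMat_transpose]
  · simp [sub_mul, mul_sub, projMat_mul_projMat (D.transpose_W_mul_W k)]

end

end TuckerDecomp

end Tensors


/-! ### Matrices as tensors of order two -/

theorem exists_matricize_zero_ofMatrix (p₁ p₂ : ℕ) : ∃ e : OtherIdx ![p₁, p₂] 0 ≃ Fin p₂,
    ∀ X : Matrix (Fin p₁) (Fin p₂) ℝ,
      matricize 0 (ofMatrix X) = X.submatrix (Equiv.refl (Fin p₁)) e :=
  letI : Unique {l : Fin 2 // l ≠ 0} :=
    ⟨⟨⟨1, by decide⟩⟩, fun l => Subtype.ext (by have := l.2; change l.1 = 1; omega)⟩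
  ⟨Equiv.piUnique _, fun _ => rfl⟩

theorem exists_matricize_one_ofMatrix (p₁ p₂ : ℕ) : ∃ e : OtherIdx ![p₁, p₂] 1 ≃ Fin p₁,
    ∀ X : Matrix (Fin p₁) (Fin p₂) ℝ,
      matricize 1 (ofMatrix X) = Xᵀ.submatrix (Equiv.refl (Fin p₂)) e :=
  letI : Unique {l : Fin 2 // l ≠ 1} :=
    ⟨⟨⟨0, by decide⟩⟩, fun l => Subtype.ext (by have := l.2; change l.1 = 0; omega)⟩
  ⟨Equiv.piUnique _, fun _ => rfl⟩

theorem tucrank_ofMatrix {p₁ p₂ : ℕ} (X : Matrix (Fin p₁) (Fin p₂) ℝ) :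
    tucrank (ofMatrix X) = fun _ => X.rank := by
  funext k
  obtain ⟨e, he⟩ := exists_matricize_zero_ofMatrix p₁ p₂
  obtain ⟨f, hf⟩ := exists_matricize_one_ofMatrix p₁ p₂
  rw [tucrank]
  fin_cases k
  · exact (congrArg Matrix.rank (he X)).trans (Matrix.rank_submatrix _ _ _)
  · exact (congrArg Matrix.rank (hf X)).trans
      ((Matrix.rank_submatrix _ _ _).trans X.rank_transpose)

theorem hasBoundedGenInverse_matricize_ofMatrix {p₁ p₂ : ℕ} {X : Matrix (Fin p₁) (Fin p₂) ℝ}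
    {c : ℝ} (h : HasBoundedGenInverse X c) (k : Fin 2) :
    HasBoundedGenInverse (matricize k (ofMatrix X)) c := by
  obtain ⟨e, he⟩ := exists_matricize_zero_ofMatrix p₁ p₂
  obtain ⟨f, hf⟩ := exists_matricize_one_ofMatrix p₁ p₂
  fin_cases k
  · exact (he X).symm ▸ h.submatrix (Equiv.refl (Fin p₁)) e
  · exact (hf X).symm ▸ h.transpose.submatrix (Equiv.refl (Fin p₂)) f

theorem hasBoundedGenInverse_inv_lambdaMin {N : ℕ} {p r : Fin N → ℕ} {X : Tensor p} (hN : 1 ≤ N)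
    (hX : tucrank X = r) (hr : ∀ k, 1 ≤ r k) :
    0 < lambdaMin X r ∧ ∀ k, HasBoundedGenInverse (matricize k X) (lambdaMin X r)⁻¹ := by
  subst hX
  have : Nonempty (Fin N) := ⟨⟨0, hN⟩⟩
  have hpos : 0 < lambdaMin X (tucrank X) := by
    obtain ⟨k, hk⟩ := exists_eq_ciInf_of_finite (f := fun k => sigma (tucrank X k) (matricize k X))
    rw [lambdaMin, ← hk]
    exact sigma_rank_pos (hr k)
  refine ⟨hpos, fun k => (hasBoundedGenInverse_inv_sigma _).mono (inv_anti₀ hpos ?_)⟩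
  exact ciInf_le (f := fun k => sigma (tucrank X k) (matricize k X)) (Set.finite_range _).bddBelow k

end TuckerProj

theorem mainTheorem11 :
    (∀ (d m : ℕ) (_ : 1 ≤ d + m) (p r rs : Fin (d + m) → ℕ) (Xt Xs : Tensor p),
      tucrank Xt = r → tucrank Xs = rs → (∀ k, 1 ≤ rs k) → (∀ k, rs k ≤ r k) →
        Nonempty (TuckerDecomp Xt r) ∧
        ∀ D : TuckerDecomp Xt r,
          frobNorm (D.tangentProjPerp Xs) ≤
            2 * ((d : ℝ) + m) * frobNorm (Xt - Xs) ^ 2 / lambdaMin Xs rs) ∧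
    (∀ (p₁ p₂ r rs : ℕ) (Xt Xs : Matrix (Fin p₁) (Fin p₂) ℝ),
      Xt.rank = r → Xs.rank = rs → 1 ≤ rs → rs ≤ r →
        Nonempty (TuckerDecomp (ofMatrix Xt) (fun _ => r)) ∧
        ∀ D : TuckerDecomp (ofMatrix Xt) (fun _ => r),
          frobNorm (D.tangentProjPerp (ofMatrix Xs)) ≤
            2 * frobNorm (ofMatrix (Xt - Xs)) ^ 2 / sigma rs Xs) := by
  constructor
  · intro d m hN p r rs Xt Xs ht hs hrs _
    refine ⟨nonempty_tuckerDecomp ht, fun D => ?_⟩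
    obtain ⟨hpos, hinv⟩ := hasBoundedGenInverse_inv_lambdaMin hN hs hrs
    have h := D.frobNorm_tangentProjPerp_le (inv_nonneg.2 hpos.le) hinv
    -- The bound `h` already has constant `d + m`; nonnegativity allows doubling it.
    have h0 : 0 ≤ ((d : ℝ) + m) * ((lambdaMin Xs rs)⁻¹ * frobNorm (Xt - Xs) ^ 2) := by positivity
    push_cast at h
    calc _ ≤ _ := h
      _ ≤ 2 * (((d : ℝ) + m) * ((lambdaMin Xs rs)⁻¹ * frobNorm (Xt - Xs) ^ 2)) := by linarith
      _ = _ := by rw [div_eq_mul_inv]; ring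
  · intro p₁ p₂ r rs Xt Xs ht hs hrs _
    subst ht hs
    refine ⟨nonempty_tuckerDecomp (tucrank_ofMatrix Xt), fun D => ?_⟩
    have h := D.frobNorm_tangentProjPerp_le (inv_nonneg.2 (sigma_rank_pos hrs).le)
      (hasBoundedGenInverse_matricize_ofMatrix (hasBoundedGenInverse_inv_sigma Xs))
    -- Here the constant 2 is the number of modes; both matricizations share the bound `(sigma
    -- Xs.rank Xs)⁻¹`, being `Xs` and its transpose up to reindexing.
    refine h.trans_eq ?_
    rw [show ofMatrix Xt - ofMatrix Xs = ofMatrix (Xt - Xs) from rfl, div_eq_mul_inv]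
    push_cast
    ring
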